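/- Let $G$ be a group equipped with a $\sigma$-field (for instance a discrete group with all its subsets) and let $\mu$ be a probability measure on $G$. Let $\Omega=G^{\mathbb N^*}$, $\mathbb N^*=\{1,2,\dots\}$, carry the product $\sigma$-field and the product measure $\mathbb P^\mu=\mu^{\mathbb N^*}$; let $X_n(\omega)=\omega_n$ be the coordinate maps (the i.i.d. increments of the random walk $Z_n=X_1\cdots X_n$), $\mathcal F_n=\sigma(X_1,\dots,X_n)$, and let $\theta_n$ be the $n$-fold shift, $(\theta_n\omega)_j=\omega_{n+j}$. A defective adapted cocycle is a sequence $\mathcal Q=(Q_n)_{n\ge 0}$ of maps $Q_n:\Omega\to\mathbb R$ with $Q_0=0$ and $Q_n$ measurable with respect to $\mathcal F_n$; its defect is $$\Psi_{n,m}(\omega)=Q_{n+m}(\omega)-Q_n(\omega)-Q_m(\theta_n\omega),\qquad n,m\in\mathbb N .$$ **Theorem.** Let $\mathcal Q$ be a defective adapted cocycle with a finite second moment, $\mathbb E^\mu[|Q_1|^2]<\infty$, that satisfies the second-moment deviation inequality: there is a finite constant $\tau$ such that $\mathbb E^\mu[|\Psi_{n,m}|^2]\le\tau$ for all $n,m\in\mathbb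 N$. Then every $Q_n$ is square integrable with respect to $\mathbb P^\mu$; the rate of escape $$\ell(\mathcal Q;\mu)=\lim_{n\to\infty}\frac1n Q_n\ \text{ in } L^1(\mathbb P^\mu),\qquad \ell(\mathcal Q;\mu)=\lim_{n\to\infty}\frac1n\,\mathbb E^\mu[Q_n],$$ and the asymptotic variance $$\sigma^2(\mathcal Q;\mu)=\lim_{n\to\infty}\frac1n\operatorname{Var}^\mu(Q_n)\in[0,\infty)$$ exist; and the law of $\frac1{\sqrt n}\bigl(Q_n-\ell(\mathcal Q;\mu)\,n\bigr)$ under $\mathbb P^\mu$ converges weakly, as $n\to\infty$, to the Gaussian law with mean $0$ and variance $\sigma^2(\mathcal Q;\mu)$ (the Dirac mass at $0$ if $\sigma^2(\mathcal Q;\mu)=0$). -/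

import Mathlib

open MeasureTheory ProbabilityTheory Filter Topology
open scoped NNReal ENNReal

namespace RandomWalk

/-- The space of increment sequences of a walk on `G`. The sequence `(X₁, X₂, …)` is indexed
from `0`: the `(j + 1)`-st increment of the walk is `X_{j+1}(ω) = ω j`. It carries the product
`σ`-field. -/
abbrev PathSpace (G : Type*) := ℕ → G

/-- The shift `θ_n`, forgetting the first `n` increments: `X_j ∘ θ_n = X_{n+j}`. -/
def shift {G : Type*} (n : ℕ) (ω : PathSpace G) : PathSpace G := fun j => ω (n + j)

/-- The law `ℙ^μ` of the increments: they are independent with common law `μ`. -/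
noncomputable def pathMeasure {G : Type*} [MeasurableSpace G] (μ : Measure G)
    [IsProbabilityMeasure μ] : Measure (PathSpace G) :=
  Measure.infinitePi fun _ : ℕ => μ

instance {G : Type*} [MeasurableSpace G] (μ : Measure G) [IsProbabilityMeasure μ] :
    IsProbabilityMeasure (pathMeasure μ) := by
  unfold pathMeasure; infer_instance

/-- The `σ`-field `ℱ_n` generated by the first `n` increments `X₁, …, X_n`. -/
@[reducible] def incrementSigma (G : Type*) [mG : MeasurableSpace G] (n : ℕ) :
    MeasurableSpace (PathSpace G) :=
  ⨆ j : Fin n, MeasurableSpace.comap (fun ω : PathSpace G => ω j) mG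

/-- A defective adapted cocycle: real-valued maps `Q_n` on the path space, `Q_n` being
measurable with respect to `ℱ_n`, with the convention `Q_0 = 0`. -/
structure DefectiveAdaptedCocycle (G : Type*) [MeasurableSpace G] where
  /-- The maps `Q_n`. -/
  toFun : ℕ → PathSpace G → ℝ
  zero' : ∀ ω, toFun 0 ω = 0
  adapted' : ∀ n, Measurable[incrementSigma G n] (toFun n)

namespace DefectiveAdaptedCocycle

variable {G : Type*} [MeasurableSpace G]

instance : CoeFun (DefectiveAdaptedCocycle G) (fun _ => ℕ → PathSpace G → ℝ) := ⟨toFun⟩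

/-- The defect `Ψ_{n,m}(ω) = Q_{n+m}(ω) - Q_n(ω) - Q_m(θ_n ω)`. -/
def defect (Q : DefectiveAdaptedCocycle G) (n m : ℕ) (ω : PathSpace G) : ℝ :=
  Q (n + m) ω - Q n ω - Q m (shift n ω)

/-- Finite `p`-th moment: `𝔼^μ[|Q_1|^p] < ∞`. -/
def HasFiniteMoment (Q : DefectiveAdaptedCocycle G) (μ : Measure G) [IsProbabilityMeasure μ]
    (p : ℝ) : Prop :=
  ∫⁻ ω, ‖Q 1 ω‖ₑ ^ p ∂(pathMeasure μ) < ∞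

/-- The `p`-th-moment deviation inequality: `𝔼^μ[|Ψ_{n,m}|^p] ≤ τ` for all `n, m`, for some
finite constant `τ`. -/
def MomentDeviationInequality (Q : DefectiveAdaptedCocycle G) (μ : Measure G)
    [IsProbabilityMeasure μ] (p : ℝ) : Prop :=
  ∃ τ : ℝ≥0, ∀ n m : ℕ, ∫⁻ ω, ‖Q.defect n m ω‖ₑ ^ p ∂(pathMeasure μ) ≤ τ

/-- `ℓ` is the rate of escape of `Q`: the limit of `Q_n / n` in `L¹(ℙ^μ)`. -/
def IsRateOfEscape (Q : DefectiveAdaptedCocycle G) (μ : Measure G) [IsProbabilityMeasure μ]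
    (l : ℝ) : Prop :=
  Tendsto (fun n : ℕ => eLpNorm (fun ω => Q n ω / (n : ℝ) - l) 1 (pathMeasure μ)) atTop (𝓝 0)

/-- `v` is the asymptotic variance `σ²(Q; μ)` of `Q`: the limit of `Var^μ(Q_n) / n`. -/
def IsAsymptoticVariance (Q : DefectiveAdaptedCocycle G) (μ : Measure G)
    [IsProbabilityMeasure μ] (v : ℝ≥0) : Prop :=
  Tendsto (fun n : ℕ => variance (Q n) (pathMeasure μ) / (n : ℝ)) atTop (𝓝 (v : ℝ))

end DefectiveAdaptedCocycle

end RandomWalk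

/-! Cut the increments into blocks of length `m`. The values of `Q m` on the blocks are i.i.d., so
their sum obeys the classical central limit theorem, and everything rests on bounding the difference
`blockError m N` between `Q (N * m)` and this sum. Block sums are exactly additive, so joining `N`
and `M` blocks produces two independent errors plus a single defect (`blockError_add`). Hence the
standard deviations satisfy `s (N + M) ≤ √(s N ^ 2 + s M ^ 2) + T` with `s 1 = 0`, which forces `s N
≤ 11 * T * √N` (`le_mul_sqrt_of_le_sqrt_add_sq`). This bound does not depend on `m`: after division
by `√(N * m)` the error is `O(1 / √m)`, uniformly in `N`. Comparing `m` and `N` with `N * m` then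
shows that `√Var / √n` is Cauchy; the means are treated likewise with error `O(1 / m)`. For the
limit law, characteristic functions of `Q n` and of the block sum are compared
(`norm_charFun_sub_le`), with `n → ∞` for a fixed large `m`. -/

/-! ### Standard deviations and characteristic functions -/

theorem ProbabilityTheory.covariance_sq_le {Ω : Type*} {mΩ : MeasurableSpace Ω} {P : Measure Ω}
    [IsFiniteMeasure P] {X Y : Ω → ℝ} (hX : MemLp X 2 P) (hY : MemLp Y 2 P) :
    cov[X, Y; P] ^ 2 ≤ Var[X; P] * Var[Y; P] := by
  have h (s : ℝ) : 0 ≤ Var[Y; P] * (s * s) + 2 * cov[X, Y; P] * s + Var[X; P] := by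
    have := variance_nonneg (X + s • Y) P
    rw [variance_add hX (hY.const_smul s), variance_smul, covariance_smul_right] at this
    linarith
  have := discrim_le_zero h
  rw [discrim] at this
  linarith

theorem ProbabilityTheory.sqrt_variance_add_le {Ω : Type*} {mΩ : MeasurableSpace Ω}
    {P : Measure Ω} [IsFiniteMeasure P] {X Y : Ω → ℝ} (hX : MemLp X 2 P) (hY : MemLp Y 2 P) :
    √Var[X + Y; P] ≤ √Var[X; P] + √Var[Y; P] := by
  have hX0 := variance_nonneg X P
  have hY0 := variance_nonneg Y P
  have hc : cov[X, Y; P] ≤ √Var[X; P] * √Var[Y; P] := by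
    rw [← Real.sqrt_mul hX0]
    exact Real.le_sqrt_of_sq_le (covariance_sq_le hX hY)
  rw [Real.sqrt_le_iff]
  refine ⟨by positivity, ?_⟩
  rw [variance_add hX hY, add_sq, Real.sq_sqrt hX0, Real.sq_sqrt hY0]
  linarith

theorem ProbabilityTheory.sqrt_variance_sub_le {Ω : Type*} {mΩ : MeasurableSpace Ω}
    {P : Measure Ω} [IsFiniteMeasure P] {X Y : Ω → ℝ} (hX : MemLp X 2 P) (hY : MemLp Y 2 P) :
    √Var[X - Y; P] ≤ √Var[X; P] + √Var[Y; P] := by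
  simpa [sub_eq_add_neg, variance_neg] using sqrt_variance_add_le hX hY.neg

theorem ProbabilityTheory.sqrt_variance_const_mul {Ω : Type*} {mΩ : MeasurableSpace Ω}
    (P : Measure Ω) (c : ℝ) (X : Ω → ℝ) :
    √Var[fun ω => c * X ω; P] = |c| * √Var[X; P] := by
  rw [variance_const_mul, Real.sqrt_mul (sq_nonneg c), Real.sqrt_sq_eq_abs]

/-- The `L¹` norm is at most the standard deviation plus the modulus of the mean. -/
theorem ProbabilityTheory.integral_abs_le_sqrt_variance_add {Ω : Type*} {mΩ : MeasurableSpace Ω}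
    {P : Measure Ω} [IsProbabilityMeasure P] {X : Ω → ℝ} (hX : MemLp X 2 P) :
    ∫ ω, |X ω| ∂P ≤ √Var[X; P] + |∫ ω, X ω ∂P| := by
  have hI : Integrable X P := hX.integrable (by norm_num)
  set Y : Ω → ℝ := fun ω => |X ω - ∫ ω, X ω ∂P| with hYdef
  have hY : MemLp Y 2 P := (hX.sub (memLp_const _)).abs
  have h1 : ∫ ω, Y ω ∂P ≤ √Var[X; P] := by
    apply Real.le_sqrt_of_sq_le
    have := variance_nonneg Y P
    rw [variance_eq_sub hY] at this
    rw [variance_eq_integral hX.1.aemeasurable]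
    simpa [hYdef, sq_abs] using this
  calc ∫ ω, |X ω| ∂P ≤ ∫ ω, (Y ω + |∫ ω, X ω ∂P|) ∂P := by
        refine integral_mono hI.abs ((hY.integrable (by norm_num)).add (integrable_const _)) ?_
        intro ω
        have := abs_add_le (X ω - ∫ ω, X ω ∂P) (∫ ω, X ω ∂P)
        simpa [hYdef] using this
    _ = ∫ ω, Y ω ∂P + |∫ ω, X ω ∂P| := by
        rw [integral_add (hY.integrable (by norm_num)) (integrable_const _)]
        simp
    _ ≤ _ := by linarith

theorem Complex.norm_exp_mul_I_sub_exp_mul_I_le (x y : ℝ) :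
    ‖Complex.exp (x * Complex.I) - Complex.exp (y * Complex.I)‖ ≤ |x - y| := by
  have h : Complex.exp (x * Complex.I) - Complex.exp (y * Complex.I)
      = Complex.exp (y * Complex.I) *
        (Complex.exp (Complex.I * ((x - y : ℝ) : ℂ)) - 1) := by
    rw [mul_sub, ← Complex.exp_add, mul_one]
    congr 2
    push_cast
    ring
  rw [h, norm_mul, Complex.norm_exp_ofReal_mul_I, one_mul]
  exact Real.norm_exp_I_mul_ofReal_sub_one_le

/-- Since `x ↦ exp (i t x)` is `|t|`-Lipschitz, the `L¹` distance controls the left side. It is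
split into deviation and mean because the two are estimated by different arguments. -/
theorem ProbabilityTheory.norm_charFun_map_sub_le {Ω : Type*} {mΩ : MeasurableSpace Ω}
    {P : Measure Ω} [IsProbabilityMeasure P] {X Y : Ω → ℝ} (hX : MemLp X 2 P) (hY : MemLp Y 2 P)
    (t : ℝ) :
    ‖charFun (P.map X) t - charFun (P.map Y) t‖
      ≤ |t| * (√Var[X - Y; P] + |∫ ω, (X - Y) ω ∂P|) := by
  have hi {Z : Ω → ℝ} (hZ : MemLp Z 2 P) :
      Integrable (fun ω => Complex.exp (((t * Z ω : ℝ) : ℂ) * Complex.I)) P := by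
    have hm : AEMeasurable Z P := hZ.1.aemeasurable
    refine Integrable.of_bound (C := 1) (AEMeasurable.aestronglyMeasurable (by fun_prop)) ?_
    exact ae_of_all _ fun ω => (Complex.norm_exp_ofReal_mul_I _).le
  have he {Z : Ω → ℝ} (hZ : MemLp Z 2 P) :
      charFun (P.map Z) t = ∫ ω, Complex.exp (((t * Z ω : ℝ) : ℂ) * Complex.I) ∂P := by
    rw [charFun_apply_real, integral_map hZ.1.aemeasurable (by fun_prop)]
    simp
  rw [he hX, he hY, ← integral_sub (hi hX) (hi hY)]
  calc _ ≤ ∫ ω, |t| * |(X - Y) ω| ∂P := by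
        refine norm_integral_le_of_norm_le
          ((((hX.sub hY).integrable (by norm_num)).abs).const_mul _) (ae_of_all _ fun ω => ?_)
        refine (Complex.norm_exp_mul_I_sub_exp_mul_I_le _ _).trans_eq ?_
        rw [← mul_sub, abs_mul]
        rfl
    _ = |t| * ∫ ω, |(X - Y) ω| ∂P := integral_const_mul _ _
    _ ≤ _ := by
        gcongr
        exact integral_abs_le_sqrt_variance_add (hX.sub hY)

theorem ProbabilityTheory.tendsto_charFun_pow_gaussian {Ω : Type*} {mΩ : MeasurableSpace Ω}
    {P : Measure Ω} [IsProbabilityMeasure P] {X : Ω → ℝ} (hX : MemLp X 2 P)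
    (h0 : ∫ ω, X ω ∂P = 0) (t : ℝ) :
    Tendsto (fun n : ℕ => charFun (P.map X) ((√n)⁻¹ * t) ^ n) atTop
      (𝓝 (Complex.exp (-(Var[X; P] * t ^ 2 / 2 : ℝ)))) := by
  have hm := hX.1.aemeasurable
  rcases eq_or_ne Var[X; P] 0 with hV | hV
  · have hX0 : X =ᵐ[P] fun _ => (0 : ℝ) := by
      filter_upwards [ae_eq_integral_of_variance_eq_zero hX hV] with ω hω
      rw [hω, h0]
    have : P.map X = Measure.dirac 0 := by
      rw [Measure.map_congr hX0, Measure.map_const]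
      simp
    simp [this, hV]
  · have hpos : 0 < Var[X; P] := lt_of_le_of_ne (variance_nonneg _ _) hV.symm
    set s := √Var[X; P] with hs
    have hs0 : 0 < s := Real.sqrt_pos.2 hpos
    have hss : s ^ 2 = Var[X; P] := Real.sq_sqrt hpos.le
    -- The unit-variance limit is applied to `s⁻¹ * X` at the point `s * t`, where the two scalings
    -- cancel.
    have key := tendsto_charFun_inv_sqrt_mul_pow (P := P) (X := fun ω => s⁻¹ * X ω)
      (hm.const_mul _) (by rw [integral_const_mul, h0, mul_zero])
      (by
        have h2 : ∫ ω, X ω ^ 2 ∂P = s ^ 2 := by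
          rw [hss, variance_of_integral_eq_zero hm h0]
        have : ((fun ω => s⁻¹ * X ω) ^ 2 : Ω → ℝ) = fun ω => (s⁻¹) ^ 2 * X ω ^ 2 := by
          ext ω; simp [mul_pow]
        rw [this, integral_const_mul, h2]
        field_simp) (s * t)
    have e (n : ℕ) : charFun (P.map fun ω => s⁻¹ * X ω) ((√n)⁻¹ * (s * t))
        = charFun (P.map X) ((√n)⁻¹ * t) := by
      rw [charFun_map_mul_comp hm]
      congr 1
      field_simp
    simp_rw [e] at key
    convert key using 3
    rw [← hss]
    push_cast
    ring

/-! ### Growth of almost Pythagorean sequences -/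

/-- A sequence that behaves, up to a bounded error, like the standard deviation of a sum of
independent variables grows at most like a square root. -/
theorem le_mul_sqrt_of_le_sqrt_add_sq {s : ℕ → ℝ} {T : ℝ} (hT : 0 ≤ T) (hs : ∀ n, 0 ≤ s n)
    (h1 : s 1 = 0)
    (hadd : ∀ N M, 1 ≤ N → 1 ≤ M → s (N + M) ≤ √(s N ^ 2 + s M ^ 2) + T) {N : ℕ} (hN : 1 ≤ N) :
    s N ≤ 11 * T * √N := by
  -- The `-4` gives the induction room to absorb the additive `T`: the root is bounded by `T * (11 *
  -- z - 5)`, one `T` below the target.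
  suffices h : s N ≤ T * (11 * √N - 4) by nlinarith
  induction N using Nat.strong_induction_on with
  | _ N ih =>
    rcases hN.eq_or_lt with rfl | hN2
    · rw [h1]; norm_num; positivity
    -- A balanced splitting keeps `(√K + √M) / √(K + M)` at least `4 / 3`, away from `1`; the gain
    -- in the linear terms of `hsq` comes from this.
    obtain ⟨K, M, hK, hKM, hMK, rfl⟩ : ∃ K M, 1 ≤ K ∧ K ≤ M ∧ M ≤ 2 * K ∧ N = K + M :=
      ⟨N / 2, N - N / 2, by omega, by omega, by omega, by omega⟩
    have iK := ih K (by omega) hK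
    have iM := ih M (by omega) (by omega)
    have hKr : (1 : ℝ) ≤ K := by exact_mod_cast hK
    have hKMr : (K : ℝ) ≤ M := by exact_mod_cast hKM
    have hMKr : (M : ℝ) ≤ 2 * K := by exact_mod_cast hMK
    set x := √(K : ℝ)
    set y := √(M : ℝ)
    set z := √((K + M : ℕ) : ℝ)
    have hx2 : x ^ 2 = K := Real.sq_sqrt (by positivity)
    have hy2 : y ^ 2 = M := Real.sq_sqrt (by positivity)
    have hz2 : z ^ 2 = x ^ 2 + y ^ 2 := by
      rw [hx2, hy2, ← Nat.cast_add]; exact Real.sq_sqrt (by positivity)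
    have hx1 : 1 ≤ x := Real.one_le_sqrt.2 hKr
    have hy1 : 1 ≤ y := Real.one_le_sqrt.2 (hKr.trans hKMr)
    have hz1 : 1 ≤ z := Real.one_le_sqrt.2 (by push_cast; linarith)
    have hxy : x ≤ y := Real.sqrt_le_sqrt hKMr
    have hyx : y ≤ 3 / 2 * x := by
      refine abs_le_of_sq_le_sq' ?_ (by linarith) |>.2
      nlinarith
    have hsum : 4 / 3 * z ≤ x + y := by
      refine abs_le_of_sq_le_sq' ?_ (by linarith) |>.2
      nlinarith [mul_nonneg (sub_nonneg.2 hxy) (sub_nonneg.2 hyx)]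
    have hsq : (11 * x - 4) ^ 2 + (11 * y - 4) ^ 2 ≤ (11 * z - 5) ^ 2 := by nlinarith
    have hroot : √(s K ^ 2 + s M ^ 2) ≤ T * (11 * z - 5) := by
      rw [Real.sqrt_le_iff]
      refine ⟨mul_nonneg hT (by linarith), ?_⟩
      calc s K ^ 2 + s M ^ 2 ≤ (T * (11 * x - 4)) ^ 2 + (T * (11 * y - 4)) ^ 2 := by
            gcongr
            · exact hs K
            · exact hs M
        _ = T ^ 2 * ((11 * x - 4) ^ 2 + (11 * y - 4) ^ 2) := by ring
        _ ≤ T ^ 2 * (11 * z - 5) ^ 2 := by gcongr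
        _ = _ := by ring
    have := hadd K M hK (hK.trans hKM)
    linarith

/-! ### Shift invariance and independence of past and future -/

namespace RandomWalk

theorem shift_shift {G : Type*} (n m : ℕ) (ω : PathSpace G) : shift m (shift n ω) = shift (n + m) ω := by
  funext j
  simp [shift, add_assoc]

variable {G : Type*} [mG : MeasurableSpace G]

theorem measurePreserving_shift (μ : Measure G) [IsProbabilityMeasure μ] (n : ℕ) :
    MeasurePreserving (shift n) (pathMeasure μ) (pathMeasure μ) where
  measurable := measurable_pi_lambda _ fun j => measurable_pi_apply (n + j)
  map_eq := Measure.map_infinitePi_infinitePi_of_inj (P := fun _ : ℕ => μ)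
    (f := fun j => n + j) (add_right_injective n)

theorem incrementSigma_le (n : ℕ) : incrementSigma G n ≤ MeasurableSpace.pi :=
  iSup_le fun j => (measurable_pi_apply (j : ℕ)).comap_le

theorem incrementSigma_mono {n m : ℕ} (h : n ≤ m) : incrementSigma G n ≤ incrementSigma G m :=
  iSup_le fun j => le_iSup (fun j : Fin m =>
    MeasurableSpace.comap (fun ω : PathSpace G => ω j) mG) (Fin.castLE h j)

theorem measurable_shift_incrementSigma (n m : ℕ) :
    Measurable[incrementSigma G (n + m), incrementSigma G m] (shift n) := by
  refine Measurable.of_comap_le ?_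
  rw [MeasurableSpace.comap_iSup]
  refine iSup_le fun j => ?_
  rw [MeasurableSpace.comap_comp]
  exact le_iSup (fun j : Fin (n + m) =>
    MeasurableSpace.comap (fun ω : PathSpace G => ω j) mG) (Fin.natAdd n j)

/-- The two functions depend on disjoint sets of coordinates, those below `n` and those from `n` on.
-/
theorem indepFun_comp_shift (μ : Measure G) [IsProbabilityMeasure μ] {n : ℕ}
    {f g : PathSpace G → ℝ} (hf : Measurable[incrementSigma G n] f) (hg : Measurable g) :
    IndepFun f (fun ω => g (shift n ω)) (pathMeasure μ) := by
  have hind : iIndep (fun j : ℕ => MeasurableSpace.comap (fun ω : PathSpace G => ω j) mG)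
      (pathMeasure μ) :=
    iIndepFun_infinitePi (P := fun _ : ℕ => μ) (X := fun _ x => x) fun _ => measurable_id
  have hdis : Disjoint (Set.Iio n) (Set.Ici n) :=
    Set.disjoint_left.2 fun j h1 h2 => (Set.mem_Iio.1 h1).not_ge (Set.mem_Ici.1 h2)
  have key := indep_iSup_of_disjoint (fun j => (measurable_pi_apply j).comap_le) hind hdis
  rw [IndepFun_iff_Indep]
  refine indep_of_indep_of_le_left (indep_of_indep_of_le_right key ?_) ?_
  · rw [← Function.comp_def g, ← MeasurableSpace.comap_comp]
    refine (MeasurableSpace.comap_mono hg.comap_le).trans ?_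
    rw [MeasurableSpace.pi, MeasurableSpace.comap_iSup]
    refine iSup_le fun j => ?_
    rw [MeasurableSpace.comap_comp]
    exact le_iSup₂ (f := fun (j : ℕ) (_ : j ∈ Set.Ici n) =>
      MeasurableSpace.comap (fun ω : PathSpace G => ω j) mG) (n + j) (Nat.le_add_right n j)
  · refine hf.comap_le.trans (iSup_le fun j => ?_)
    exact le_iSup₂ (f := fun (j : ℕ) (_ : j ∈ Set.Iio n) =>
      MeasurableSpace.comap (fun ω : PathSpace G => ω j) mG) (j : ℕ) j.2

end RandomWalk

/-! ### Square integrability and bounds on the defect -/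

theorem MeasureTheory.memLp_two_of_lintegral_lt_top {Ω : Type*} {mΩ : MeasurableSpace Ω}
    {P : Measure Ω} {f : Ω → ℝ} (hf : Measurable f) (h : ∫⁻ ω, ‖f ω‖ₑ ^ (2 : ℝ) ∂P < ∞) :
    MemLp f 2 P :=
  ⟨hf.aestronglyMeasurable,
    (eLpNorm_lt_top_iff_lintegral_rpow_enorm_lt_top (by norm_num) (by norm_num)).2
      (by simpa using h)⟩

theorem MeasureTheory.integral_sq_le_of_lintegral_le {Ω : Type*} {mΩ : MeasurableSpace Ω}
    {P : Measure Ω} {f : Ω → ℝ} {τ : ℝ≥0} (hf : Measurable f)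
    (h : ∫⁻ ω, ‖f ω‖ₑ ^ (2 : ℝ) ∂P ≤ τ) : ∫ ω, f ω ^ 2 ∂P ≤ τ := by
  rw [integral_eq_lintegral_of_nonneg_ae (ae_of_all _ fun ω => sq_nonneg (f ω))
    (hf.pow_const 2).aestronglyMeasurable]
  refine ENNReal.toReal_le_of_le_ofReal τ.2 ?_
  refine le_trans (le_of_eq ?_) (h.trans_eq (ENNReal.ofReal_coe_nnreal (p := τ)).symm)
  refine lintegral_congr fun ω => ?_
  rw [← sq_abs, ENNReal.ofReal_pow (abs_nonneg _), ← Real.enorm_eq_ofReal_abs]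
  simp

theorem ProbabilityTheory.abs_integral_le_sqrt_integral_sq {Ω : Type*} {mΩ : MeasurableSpace Ω}
    {P : Measure Ω} [IsProbabilityMeasure P] {X : Ω → ℝ} (hX : MemLp X 2 P) :
    |∫ ω, X ω ∂P| ≤ √(∫ ω, X ω ^ 2 ∂P) := by
  refine Real.abs_le_sqrt ?_
  have := variance_nonneg X P
  rw [variance_eq_sub hX] at this
  simpa using this

namespace RandomWalk.DefectiveAdaptedCocycle

variable {G : Type*} [MeasurableSpace G] (Q : DefectiveAdaptedCocycle G) {μ : Measure G}
  [IsProbabilityMeasure μ]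

theorem measurable (n : ℕ) : Measurable (Q n) :=
  (Q.adapted' n).mono (incrementSigma_le n) le_rfl

theorem measurable_defect (n m : ℕ) : Measurable (Q.defect n m) :=
  ((Q.measurable (n + m)).sub (Q.measurable n)).sub
    ((Q.measurable m).comp (measurable_pi_lambda _ fun j => measurable_pi_apply (n + j)))

theorem memLp_comp_shift {f : PathSpace G → ℝ} (hf : MemLp f 2 (pathMeasure μ)) (n : ℕ) :
    MemLp (fun ω => f (shift n ω)) 2 (pathMeasure μ) :=
  hf.comp_measurePreserving (measurePreserving_shift μ n)

theorem integral_comp_shift {f : PathSpace G → ℝ} (hf : Measurable f) (n : ℕ) :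
    ∫ ω, f (shift n ω) ∂pathMeasure μ = ∫ ω, f ω ∂pathMeasure μ := by
  have h := measurePreserving_shift μ n
  conv_rhs => rw [← h.map_eq]
  exact (integral_map h.aemeasurable hf.aestronglyMeasurable).symm

theorem variance_comp_shift {f : PathSpace G → ℝ} (hf : Measurable f) (n : ℕ) :
    Var[fun ω => f (shift n ω); pathMeasure μ] = Var[f; pathMeasure μ] :=
  (measurePreserving_shift μ n).variance_fun_comp hf.aemeasurable

theorem add_eq (n m : ℕ) :
    Q (n + m) = Q n + (fun ω => Q m (shift n ω)) + Q.defect n m := by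
  ext ω
  simp [defect]

theorem memLp_two (hmoment : Q.HasFiniteMoment μ 2)
    (hdev : Q.MomentDeviationInequality μ 2) (n : ℕ) : MemLp (Q n) 2 (pathMeasure μ) := by
  obtain ⟨τ, hτ⟩ := hdev
  induction n with
  | zero =>
    have : Q 0 = fun _ => 0 := funext Q.zero'
    rw [this]
    exact memLp_const 0
  | succ n ih =>
    rw [add_eq]
    refine (ih.add (memLp_comp_shift (memLp_two_of_lintegral_lt_top (Q.measurable 1) hmoment)
      n)).add ?_
    exact memLp_two_of_lintegral_lt_top (Q.measurable_defect n 1)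
      ((hτ n 1).trans_lt ENNReal.coe_lt_top)

theorem memLp_defect (hQ : ∀ n, MemLp (Q n) 2 (pathMeasure μ)) (n m : ℕ) :
    MemLp (Q.defect n m) 2 (pathMeasure μ) :=
  ((hQ (n + m)).sub (hQ n)).sub (memLp_comp_shift (hQ m) n)

theorem exists_defect_bound (hQ : ∀ n, MemLp (Q n) 2 (pathMeasure μ))
    (hdev : Q.MomentDeviationInequality μ 2) :
    ∃ T : ℝ, 0 ≤ T ∧ (∀ n m, √Var[Q.defect n m; pathMeasure μ] ≤ T) ∧
      ∀ n m, |∫ ω, Q.defect n m ω ∂pathMeasure μ| ≤ T := by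
  obtain ⟨τ, hτ⟩ := hdev
  have h (n m : ℕ) := integral_sq_le_of_lintegral_le (Q.measurable_defect n m) (hτ n m)
  refine ⟨√τ, Real.sqrt_nonneg _, fun n m => Real.sqrt_le_sqrt ?_, fun n m => ?_⟩
  · refine (variance_le_expectation_sq (Q.measurable_defect n m).aestronglyMeasurable).trans ?_
    simpa using h n m
  · exact (abs_integral_le_sqrt_integral_sq (Q.memLp_defect hQ n m)).trans
      (Real.sqrt_le_sqrt (h n m))

/-! ### Sums over independent blocks -/

/-- The sum of the values of `Q_m` on `N` consecutive disjoint blocks of length `m`. -/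
def blockSum (m N : ℕ) (ω : PathSpace G) : ℝ :=
  ∑ i ∈ Finset.range N, Q m (shift (i * m) ω)

theorem blockSum_add (m N M : ℕ) :
    Q.blockSum m (N + M)
      = Q.blockSum m N + fun ω => Q.blockSum m M (shift (N * m) ω) := by
  ext ω
  simp [blockSum, Finset.sum_range_add, shift_shift, add_mul]

theorem measurable_blockSum_incrementSigma (m N : ℕ) :
    Measurable[incrementSigma G (N * m)] (Q.blockSum m N) := by
  refine Finset.measurable_fun_sum _ fun i hi => ?_
  have hi' : i * m + m ≤ N * m := by
    rw [← Nat.succ_mul]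
    exact Nat.mul_le_mul_right m (Finset.mem_range.1 hi)
  exact ((Q.adapted' m).comp (measurable_shift_incrementSigma (i * m) m)).mono
    (incrementSigma_mono hi') le_rfl

theorem measurable_blockSum (m N : ℕ) : Measurable (Q.blockSum m N) :=
  (Q.measurable_blockSum_incrementSigma m N).mono (incrementSigma_le _) le_rfl

theorem memLp_blockSum (hQ : ∀ n, MemLp (Q n) 2 (pathMeasure μ)) (m N : ℕ) :
    MemLp (Q.blockSum m N) 2 (pathMeasure μ) :=
  memLp_finsetSum _ fun i _ => memLp_comp_shift (hQ m) (i * m)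

theorem blockSum_one (m : ℕ) : Q.blockSum m 1 = Q m := by
  ext ω
  have : shift 0 ω = ω := funext fun j => congrArg ω (zero_add j)
  simp [blockSum, this]

theorem blockSum_zero (m : ℕ) : Q.blockSum m 0 = 0 := by
  ext ω
  simp [blockSum]

theorem variance_blockSum (hQ : ∀ n, MemLp (Q n) 2 (pathMeasure μ)) (m N : ℕ) :
    Var[Q.blockSum m N; pathMeasure μ] = N * Var[Q m; pathMeasure μ] := by
  induction N with
  | zero => simp [blockSum_zero]
  | succ N ih =>
    rw [blockSum_add, blockSum_one, IndepFun.variance_add (Q.memLp_blockSum hQ m N)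
      (memLp_comp_shift (hQ m) _)
      (indepFun_comp_shift μ (Q.measurable_blockSum_incrementSigma m N) (Q.measurable m)),
      ih, variance_comp_shift (Q.measurable m)]
    push_cast
    ring

theorem integral_blockSum (hQ : ∀ n, MemLp (Q n) 2 (pathMeasure μ)) (m N : ℕ) :
    ∫ ω, Q.blockSum m N ω ∂pathMeasure μ = N * ∫ ω, Q m ω ∂pathMeasure μ := by
  unfold blockSum
  rw [integral_finsetSum _ fun i _ => (memLp_comp_shift (hQ m) (i * m)).integrable (by norm_num)]
  simp [integral_comp_shift (Q.measurable m)]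

theorem charFun_blockSum_sub (c : ℝ) (m N : ℕ) (t : ℝ) :
    charFun ((pathMeasure μ).map fun ω => Q.blockSum m N ω - N * c) t
      = charFun ((pathMeasure μ).map fun ω => Q m ω - c) t ^ N := by
  induction N with
  | zero => simp [blockSum_zero]
  | succ N ih =>
    have hf : Measurable[incrementSigma G (N * m)] fun ω => Q.blockSum m N ω - N * c :=
      (Q.measurable_blockSum_incrementSigma m N).sub_const _
    have hg : Measurable fun ω => Q m ω - c := (Q.measurable m).sub_const _
    have e : (fun ω => Q.blockSum m (N + 1) ω - (N + 1 : ℕ) * c)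
        = (fun ω => Q.blockSum m N ω - N * c)
          + (fun ω => Q m ω - c) ∘ shift (N * m) := by
      ext ω
      rw [blockSum_add, blockSum_one]
      simp only [Pi.add_apply, Function.comp_apply]
      push_cast
      ring
    have hs := measurePreserving_shift μ (N * m)
    have key := (indepFun_comp_shift μ hf hg).charFun_map_add_eq_mul
      (hf.mono (incrementSigma_le _) le_rfl).aemeasurable (hg.comp hs.measurable).aemeasurable
    rw [e, key, Pi.mul_apply, ih, pow_succ]
    congr 2
    rw [← Measure.map_map hg hs.measurable, hs.map_eq]

/-! ### The block error -/

/-- The difference between `Q_{Nm}` and the sum over `N` blocks of length `m`. -/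
def blockError (m N : ℕ) : PathSpace G → ℝ := Q (N * m) - Q.blockSum m N

theorem blockError_add (m N M : ℕ) :
    Q.blockError m (N + M) = Q.blockError m N + (fun ω => Q.blockError m M (shift (N * m) ω))
      + Q.defect (N * m) (M * m) := by
  ext ω
  simp only [blockError, Pi.sub_apply, Pi.add_apply, blockSum_add, add_mul, defect]
  ring

theorem blockError_one (m : ℕ) : Q.blockError m 1 = 0 := by
  simp [blockError, blockSum_one]

theorem measurable_blockError_incrementSigma (m N : ℕ) :
    Measurable[incrementSigma G (N * m)] (Q.blockError m N) :=
  (Q.adapted' _).sub (Q.measurable_blockSum_incrementSigma m N)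

theorem memLp_blockError (hQ : ∀ n, MemLp (Q n) 2 (pathMeasure μ)) (m N : ℕ) :
    MemLp (Q.blockError m N) 2 (pathMeasure μ) :=
  (hQ _).sub (Q.memLp_blockSum hQ m N)

/-- The central estimate. Independence adds the variances of the two errors in `blockError_add`, and
the defect costs at most `T`; the constant is free of `m`. -/
theorem sqrt_variance_blockError_le (hQ : ∀ n, MemLp (Q n) 2 (pathMeasure μ)) {T : ℝ}
    (hT : ∀ n m, √Var[Q.defect n m; pathMeasure μ] ≤ T) (m : ℕ) {N : ℕ} (hN : 1 ≤ N) :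
    √Var[Q.blockError m N; pathMeasure μ] ≤ 11 * T * √N := by
  refine le_mul_sqrt_of_le_sqrt_add_sq (s := fun N => √Var[Q.blockError m N; pathMeasure μ])
    ((Real.sqrt_nonneg _).trans (hT 0 0)) (fun _ => Real.sqrt_nonneg _)
    (by simp [blockError_one]) (fun N M _ _ => ?_) hN
  have hm : Measurable (Q.blockError m M) :=
    (Q.measurable_blockError_incrementSigma m M).mono (incrementSigma_le _) le_rfl
  have h1 := Q.memLp_blockError hQ m N
  have h2 := memLp_comp_shift (Q.memLp_blockError hQ m M) (N * m)
  simp only [Real.sq_sqrt (variance_nonneg _ _)]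
  rw [blockError_add, ← variance_comp_shift hm (N * m), ← IndepFun.variance_add h1 h2
    (indepFun_comp_shift μ (Q.measurable_blockError_incrementSigma m N) hm)]
  refine (sqrt_variance_add_le (h1.add h2) (Q.memLp_defect hQ _ _)).trans ?_
  gcongr
  exact hT _ _

/-- Each added block costs one mean defect. A bound linear in `N` suffices here, as means are
divided by `N * m` and not by its square root. -/
theorem abs_integral_sub_mul_le (hQ : ∀ n, MemLp (Q n) 2 (pathMeasure μ)) {T : ℝ}
    (hT : ∀ n m, |∫ ω, Q.defect n m ω ∂pathMeasure μ| ≤ T) (m N : ℕ) :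
    |∫ ω, Q (N * m) ω ∂pathMeasure μ - N * ∫ ω, Q m ω ∂pathMeasure μ| ≤ N * T := by
  induction N with
  | zero => simp [Q.zero']
  | succ N ih =>
    have hi (n : ℕ) : Integrable (Q n) (pathMeasure μ) := (hQ n).integrable (by norm_num)
    have h1 := (memLp_comp_shift (hQ m) (N * m)).integrable (by norm_num)
    have h2 := (Q.memLp_defect hQ (N * m) m).integrable (by norm_num)
    have e : ∫ ω, Q ((N + 1) * m) ω ∂pathMeasure μ
        = ∫ ω, Q (N * m) ω ∂pathMeasure μ + ∫ ω, Q m ω ∂pathMeasure μ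
          + ∫ ω, Q.defect (N * m) m ω ∂pathMeasure μ := by
      rw [add_mul, one_mul, add_eq, integral_add' ((hi _).add h1) h2, integral_add' (hi _) h1,
        integral_comp_shift (Q.measurable m)]
    rw [e]
    have := hT (N * m) m
    push_cast
    rw [abs_le] at *
    constructor <;> nlinarith

end RandomWalk.DefectiveAdaptedCocycle

/-! ### Existence of the rate of escape and of the asymptotic variance -/

theorem exists_tendsto_of_abs_sub_le_add {u e : ℕ → ℝ} (he : Tendsto e atTop (𝓝 0))
    (h : ∀ m N, 1 ≤ m → 1 ≤ N → |u m - u N| ≤ e m + e N) :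
    ∃ l, Tendsto u atTop (𝓝 l) ∧ ∀ n, 1 ≤ n → |u n - l| ≤ e n := by
  have hc : CauchySeq u := by
    refine Metric.cauchySeq_iff.2 fun ε hε => ?_
    obtain ⟨n₀, hn₀⟩ := eventually_atTop.1 (he.eventually_lt_const (half_pos hε))
    refine ⟨max n₀ 1, fun m hm N hN => ?_⟩
    have := h m N (le_of_max_le_right hm) (le_of_max_le_right hN)
    have h1 := hn₀ m (le_of_max_le_left hm)
    have h2 := hn₀ N (le_of_max_le_left hN)
    rw [Real.dist_eq]
    linarith
  obtain ⟨l, hl⟩ := cauchySeq_tendsto_of_complete hc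
  refine ⟨l, hl, fun n hn => ?_⟩
  have h1 : Tendsto (fun N => |u n - u N|) atTop (𝓝 |u n - l|) := (hl.const_sub (u n)).abs
  have h2 : Tendsto (fun N => e n + e N) atTop (𝓝 (e n)) := by simpa using he.const_add (e n)
  exact le_of_tendsto_of_tendsto h1 h2 (eventually_atTop.2 ⟨1, fun N hN => h n N hn hN⟩)

theorem tendsto_inv_sqrt_natCast : Tendsto (fun n : ℕ => (√(n : ℝ))⁻¹) atTop (𝓝 0) :=
  tendsto_inv_atTop_zero.comp (Real.tendsto_sqrt_atTop.comp tendsto_natCast_atTop_atTop)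

namespace RandomWalk.DefectiveAdaptedCocycle

variable {G : Type*} [MeasurableSpace G] (Q : DefectiveAdaptedCocycle G) {μ : Measure G}
  [IsProbabilityMeasure μ]

theorem abs_mean_div_sub_le (hQ : ∀ n, MemLp (Q n) 2 (pathMeasure μ)) {T : ℝ}
    (hT : ∀ n m, |∫ ω, Q.defect n m ω ∂pathMeasure μ| ≤ T) {m N : ℕ} (hm : 1 ≤ m) (hN : 1 ≤ N) :
    |(∫ ω, Q (N * m) ω ∂pathMeasure μ) / ((N * m : ℕ) : ℝ)
      - (∫ ω, Q m ω ∂pathMeasure μ) / m| ≤ T * (m : ℝ)⁻¹ := by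
  have hm' : (0 : ℝ) < m := by exact_mod_cast hm
  have hN' : (0 : ℝ) < N := by exact_mod_cast hN
  have h := Q.abs_integral_sub_mul_le hQ hT m N
  set a := ∫ ω, Q (N * m) ω ∂pathMeasure μ
  set b := ∫ ω, Q m ω ∂pathMeasure μ
  have e : a / ((N * m : ℕ) : ℝ) - b / m = (a - N * b) / (N * m) := by
    push_cast
    field_simp
  rw [e, abs_div, abs_of_pos (mul_pos hN' hm'), div_le_iff₀ (mul_pos hN' hm')]
  refine h.trans_eq ?_
  field_simp

theorem exists_mean_limit (hQ : ∀ n, MemLp (Q n) 2 (pathMeasure μ)) {T : ℝ}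
    (hT : ∀ n m, |∫ ω, Q.defect n m ω ∂pathMeasure μ| ≤ T) :
    ∃ l : ℝ, Tendsto (fun n : ℕ => (∫ ω, Q n ω ∂pathMeasure μ) / (n : ℝ)) atTop (𝓝 l) ∧
      ∀ n : ℕ, 1 ≤ n → |(∫ ω, Q n ω ∂pathMeasure μ) / (n : ℝ) - l| ≤ T * (n : ℝ)⁻¹ := by
  refine exists_tendsto_of_abs_sub_le_add (e := fun n : ℕ => T * (n : ℝ)⁻¹) ?_ fun m N hm hN => ?_
  · simpa using (tendsto_inv_atTop_nhds_zero_nat (𝕜 := ℝ)).const_mul T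
  -- Both indices are compared with their common multiple `N * m`.
  · have h1 := Q.abs_mean_div_sub_le hQ hT hm hN
    have h2 := Q.abs_mean_div_sub_le hQ hT hN hm
    rw [mul_comm m N] at h2
    rw [abs_sub_comm] at h1
    exact (abs_sub_le _ _ _).trans (add_le_add h1 h2)

theorem abs_sqrt_variance_div_sub_le (hQ : ∀ n, MemLp (Q n) 2 (pathMeasure μ)) {T : ℝ}
    (hT : ∀ n m, √Var[Q.defect n m; pathMeasure μ] ≤ T) {m N : ℕ} (hm : 1 ≤ m) (hN : 1 ≤ N) :
    |√Var[Q (N * m); pathMeasure μ] / √((N * m : ℕ) : ℝ)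
      - √Var[Q m; pathMeasure μ] / √(m : ℝ)| ≤ 11 * T * (√(m : ℝ))⁻¹ := by
  have hm' : 0 < √(m : ℝ) := Real.sqrt_pos.2 (by exact_mod_cast hm)
  have hN' : 0 < √(N : ℝ) := Real.sqrt_pos.2 (by exact_mod_cast hN)
  have hD := Q.sqrt_variance_blockError_le hQ hT m hN
  have hS : √Var[Q.blockSum m N; pathMeasure μ] = √(N : ℝ) * √Var[Q m; pathMeasure μ] := by
    rw [Q.variance_blockSum hQ, Real.sqrt_mul (Nat.cast_nonneg N)]
  have h1 : √Var[Q (N * m); pathMeasure μ]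
      ≤ √Var[Q.blockSum m N; pathMeasure μ] + √Var[Q.blockError m N; pathMeasure μ] := by
    have := sqrt_variance_add_le (Q.memLp_blockSum hQ m N) (Q.memLp_blockError hQ m N)
    rwa [blockError, add_sub_cancel] at this
  have h2 : √Var[Q.blockSum m N; pathMeasure μ]
      ≤ √Var[Q (N * m); pathMeasure μ] + √Var[Q.blockError m N; pathMeasure μ] := by
    have := sqrt_variance_sub_le (hQ (N * m)) (Q.memLp_blockError hQ m N)
    rwa [blockError, sub_sub_cancel] at this
  rw [hS] at h1 h2
  have e : √Var[Q (N * m); pathMeasure μ] / √((N * m : ℕ) : ℝ)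
      - √Var[Q m; pathMeasure μ] / √(m : ℝ)
      = (√Var[Q (N * m); pathMeasure μ] - √(N : ℝ) * √Var[Q m; pathMeasure μ])
        / (√(N : ℝ) * √(m : ℝ)) := by
    rw [Nat.cast_mul, Real.sqrt_mul (Nat.cast_nonneg N)]
    field_simp
  rw [e, abs_div, abs_of_pos (mul_pos hN' hm'), div_le_iff₀ (mul_pos hN' hm')]
  have e2 : 11 * T * (√(m : ℝ))⁻¹ * (√(N : ℝ) * √(m : ℝ)) = 11 * T * √(N : ℝ) := by
    field_simp
  rw [e2, abs_le]
  constructor <;> linarith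

theorem exists_sqrt_variance_limit (hQ : ∀ n, MemLp (Q n) 2 (pathMeasure μ)) {T : ℝ}
    (hT : ∀ n m, √Var[Q.defect n m; pathMeasure μ] ≤ T) :
    ∃ s : ℝ, Tendsto (fun n : ℕ => √Var[Q n; pathMeasure μ] / √(n : ℝ)) atTop (𝓝 s) := by
  obtain ⟨s, hs, -⟩ := exists_tendsto_of_abs_sub_le_add
    (u := fun n : ℕ => √Var[Q n; pathMeasure μ] / √(n : ℝ))
    (e := fun n : ℕ => 11 * T * (√(n : ℝ))⁻¹)
    (by simpa using tendsto_inv_sqrt_natCast.const_mul (11 * T)) fun m N hm hN => by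
      have h1 := Q.abs_sqrt_variance_div_sub_le hQ hT hm hN
      have h2 := Q.abs_sqrt_variance_div_sub_le hQ hT hN hm
      rw [mul_comm m N] at h2
      rw [abs_sub_comm] at h1
      exact (abs_sub_le _ _ _).trans (add_le_add h1 h2)
  exact ⟨s, hs⟩

/-- The standard deviation of `Q n / n` is a convergent sequence times `1 / √n`, so convergence of
the means gives convergence in `L¹`. -/
theorem isRateOfEscape_of_tendsto (hQ : ∀ n, MemLp (Q n) 2 (pathMeasure μ)) {l s : ℝ}
    (hl : Tendsto (fun n : ℕ => (∫ ω, Q n ω ∂pathMeasure μ) / (n : ℝ)) atTop (𝓝 l))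
    (hs : Tendsto (fun n : ℕ => √Var[Q n; pathMeasure μ] / √(n : ℝ)) atTop (𝓝 s)) :
    Q.IsRateOfEscape μ l := by
  have hX (n : ℕ) : MemLp (fun ω => Q n ω / (n : ℝ) - l) 2 (pathMeasure μ) := by
    simp_rw [div_eq_inv_mul]
    exact ((hQ n).const_mul ((n : ℝ)⁻¹)).sub (memLp_const l)
  have hb (n : ℕ) : eLpNorm (fun ω => Q n ω / (n : ℝ) - l) 1 (pathMeasure μ)
      ≤ ENNReal.ofReal (√Var[Q n; pathMeasure μ] / √(n : ℝ) * (√(n : ℝ))⁻¹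
        + |(∫ ω, Q n ω ∂pathMeasure μ) / (n : ℝ) - l|) := by
    have hI := (hX n).integrable (by norm_num)
    rw [eLpNorm_one_eq_lintegral_enorm, ← ofReal_integral_norm_eq_lintegral_enorm hI]
    refine ENNReal.ofReal_le_ofReal ((integral_abs_le_sqrt_variance_add (hX n)).trans_eq ?_)
    have hv : √Var[fun ω => Q n ω / (n : ℝ) - l; pathMeasure μ]
        = √Var[Q n; pathMeasure μ] / √(n : ℝ) * (√(n : ℝ))⁻¹ := by
      rw [variance_sub_const ((Q.measurable n).div_const _).aestronglyMeasurable]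
      simp_rw [div_eq_inv_mul]
      rw [sqrt_variance_const_mul, abs_of_nonneg (by positivity)]
      nth_rw 1 [← Real.mul_self_sqrt (Nat.cast_nonneg (α := ℝ) n)]
      rw [mul_inv]
      ring
    rw [hv, integral_sub (((hQ n).integrable (by norm_num)).div_const _) (integrable_const _),
      integral_div]
    simp
  have hlim : Tendsto (fun n : ℕ => ENNReal.ofReal
      (√Var[Q n; pathMeasure μ] / √(n : ℝ) * (√(n : ℝ))⁻¹
        + |(∫ ω, Q n ω ∂pathMeasure μ) / (n : ℝ) - l|)) atTop (𝓝 0) := by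
    rw [← ENNReal.ofReal_zero]
    refine ENNReal.tendsto_ofReal ?_
    simpa using (hs.mul tendsto_inv_sqrt_natCast).add (hl.sub_const l).abs
  exact tendsto_of_tendsto_of_tendsto_of_le_of_le tendsto_const_nhds hlim
    (fun _ => zero_le) hb

/-! ### The central limit theorem -/

/-- The central limit theorem for the sums of `Q_m` over blocks, for characteristic functions. -/
theorem tendsto_charFun_normalized_blockSum (hQ : ∀ n, MemLp (Q n) 2 (pathMeasure μ)) (m : ℕ)
    (t : ℝ) :
    Tendsto (fun N : ℕ => charFun ((pathMeasure μ).map fun ω =>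
        (√((N * m : ℕ) : ℝ))⁻¹ * (Q.blockSum m N ω - N * ∫ ω, Q m ω ∂pathMeasure μ)) t) atTop
      (𝓝 (Complex.exp (-((√Var[Q m; pathMeasure μ] / √(m : ℝ)) ^ 2 * t ^ 2 / 2 : ℝ)))) := by
  have hX : MemLp (fun ω => Q m ω - ∫ ω, Q m ω ∂pathMeasure μ) 2 (pathMeasure μ) :=
    (hQ m).sub (memLp_const _)
  have h0 : ∫ ω, (Q m ω - ∫ ω, Q m ω ∂pathMeasure μ) ∂pathMeasure μ = 0 := by
    rw [integral_sub ((hQ m).integrable (by norm_num)) (integrable_const _)]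
    simp
  have key := tendsto_charFun_pow_gaussian hX h0 ((√(m : ℝ))⁻¹ * t)
  rw [variance_sub_const (hQ m).1] at key
  convert key using 3 with N
  · rw [charFun_map_mul_comp ((Q.measurable_blockSum m N).sub_const _).aemeasurable,
      charFun_blockSum_sub, Nat.cast_mul, Real.sqrt_mul (Nat.cast_nonneg N), mul_inv, mul_assoc]
  · rw [div_pow, Real.sq_sqrt (variance_nonneg _ _), mul_pow, inv_pow]
    congr 2
    ring

/-- Dividing `n` by `m` leaves a tail of length `n % m < m`. The sum over all `i < m` bounds its
deviation by a quantity independent of `n`. -/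
theorem sqrt_variance_sub_blockSum_le (hQ : ∀ n, MemLp (Q n) 2 (pathMeasure μ)) {T : ℝ}
    (hT : ∀ n m, √Var[Q.defect n m; pathMeasure μ] ≤ T) {m n : ℕ} (hm : 1 ≤ m) (hn : m ≤ n) :
    √Var[Q n - Q.blockSum m (n / m); pathMeasure μ]
      ≤ 11 * T * √((n / m : ℕ) : ℝ)
        + (∑ i ∈ Finset.range m, √Var[Q i; pathMeasure μ] + T) := by
  have hN : 1 ≤ n / m := (Nat.one_le_div_iff hm).2 hn
  have e : Q n - Q.blockSum m (n / m) = Q.blockError m (n / m)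
      + ((fun ω => Q (n % m) (shift (n / m * m) ω)) + Q.defect (n / m * m) (n % m)) := by
    conv_lhs => rw [← Nat.div_add_mod' n m, add_eq, Nat.div_add_mod' n m]
    rw [blockError]
    ring
  have h1 := Q.memLp_blockError hQ m (n / m)
  have h2 := memLp_comp_shift (hQ (n % m)) (n / m * m)
  have h3 := Q.memLp_defect hQ (n / m * m) (n % m)
  rw [e]
  refine (sqrt_variance_add_le h1 (h2.add h3)).trans (add_le_add
    (Q.sqrt_variance_blockError_le hQ hT m hN) ?_)
  refine (sqrt_variance_add_le h2 h3).trans (add_le_add ?_ (hT _ _))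
  rw [variance_comp_shift (Q.measurable _)]
  exact Finset.single_le_sum (f := fun i => √Var[Q i; pathMeasure μ])
    (fun _ _ => Real.sqrt_nonneg _) (Finset.mem_range.2 (Nat.mod_lt n hm))

/-- The first term is small for large `m`, uniformly in `n`; the second vanishes as `n → ∞` with `m`
fixed. -/
theorem norm_charFun_sub_le (hQ : ∀ n, MemLp (Q n) 2 (pathMeasure μ)) {T l : ℝ}
    (hT : ∀ n m, √Var[Q.defect n m; pathMeasure μ] ≤ T)
    (hl : ∀ n : ℕ, 1 ≤ n → |(∫ ω, Q n ω ∂pathMeasure μ) / (n : ℝ) - l| ≤ T * (n : ℝ)⁻¹)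
    {m n : ℕ} (hm : 1 ≤ m) (hn : m ≤ n) (t : ℝ) :
    ‖charFun ((pathMeasure μ).map fun ω => (Q n ω - l * (n : ℝ)) / √(n : ℝ)) t
      - charFun ((pathMeasure μ).map fun ω => (√((n / m * m : ℕ) : ℝ))⁻¹ *
        (Q.blockSum m (n / m) ω - (n / m : ℕ) * ∫ ω, Q m ω ∂pathMeasure μ)) t‖
      ≤ |t| * (11 * T * (√(m : ℝ))⁻¹
        + (∑ i ∈ Finset.range m, √Var[Q i; pathMeasure μ] + T + √Var[Q m; pathMeasure μ] + T)
          * (√(n : ℝ))⁻¹) := by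
  have hT0 : 0 ≤ T := (Real.sqrt_nonneg _).trans (hT 0 0)
  have hN : 1 ≤ n / m := (Nat.one_le_div_iff hm).2 hn
  have hsub := Q.sqrt_variance_sub_blockSum_le hQ hT hm hn
  have hnm : ((n / m : ℕ) : ℝ) * m ≤ n := by exact_mod_cast Nat.div_mul_le_self n m
  have hmod : (n : ℝ) ≤ (n / m : ℕ) * m + m := by
    have h1 := Nat.div_add_mod' n m
    have h2 := Nat.mod_lt n hm
    exact_mod_cast (show n ≤ n / m * m + m by omega)
  have hln := hl n (hm.trans hn)
  have hn0 : (0 : ℝ) < n := by exact_mod_cast (hm.trans hn)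
  have hm0 : (0 : ℝ) < m := by exact_mod_cast hm
  have hN0 : (0 : ℝ) < (n / m : ℕ) := by exact_mod_cast hN
  have hS : √Var[Q.blockSum m (n / m); pathMeasure μ]
      = √((n / m : ℕ) : ℝ) * √Var[Q m; pathMeasure μ] := by
    rw [Q.variance_blockSum hQ, Real.sqrt_mul (Nat.cast_nonneg _)]
  have hSL := Q.memLp_blockSum hQ m (n / m)
  have hSE := Q.integral_blockSum hQ m (n / m)
  rw [Nat.cast_mul] at *
  set N := n / m
  set K := ∑ i ∈ Finset.range m, √Var[Q i; pathMeasure μ]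
  set a := ∫ ω, Q m ω ∂pathMeasure μ
  set b := √(n : ℝ) with hb
  set x := √(N : ℝ) with hx
  set y := √(m : ℝ) with hy
  have hb0 : 0 < b := Real.sqrt_pos.2 hn0
  have hx0 : 0 < x := Real.sqrt_pos.2 hN0
  have hy0 : 0 < y := Real.sqrt_pos.2 hm0
  have hbb : b * b = n := Real.mul_self_sqrt hn0.le
  have hxy : √((N : ℝ) * m) = x * y := Real.sqrt_mul hN0.le _
  have hxyb : x * y ≤ b := by rw [← hxy]; exact Real.sqrt_le_sqrt hnm
  have hbxy : b ≤ x * y + y := by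
    refine Real.sqrt_le_iff.2 ⟨by positivity, hmod.trans ?_⟩
    have h1 : (x * y) ^ 2 = N * m := by rw [← hxy, Real.sq_sqrt (by positivity)]
    have h2 : y ^ 2 = m := Real.sq_sqrt hm0.le
    rw [add_sq, h1, h2]
    have : 0 ≤ 2 * (x * y) * y := by positivity
    linarith
  rw [hxy]
  set W : PathSpace G → ℝ := fun ω => (Q n ω - l * (n : ℝ)) / b with hW
  set Y : PathSpace G → ℝ := fun ω => (x * y)⁻¹ * (Q.blockSum m N ω - N * a) with hY
  have hWL : MemLp W 2 (pathMeasure μ) := by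
    simpa [hW, div_eq_inv_mul] using ((hQ n).sub (memLp_const (l * (n : ℝ)))).const_mul b⁻¹
  have hYL : MemLp Y 2 (pathMeasure μ) := (hSL.sub (memLp_const _)).const_mul _
  refine (norm_charFun_map_sub_le hWL hYL t).trans ?_
  refine mul_le_mul_of_nonneg_left ?_ (abs_nonneg t)
  -- `Y` is centred, so only the drift of `Q n` remains. It is multiplied by `√n`, hence the need
  -- for the rate `T / n` in `hl`.
  have hmean : |∫ ω, (W - Y) ω ∂pathMeasure μ| ≤ T * b⁻¹ := by
    have : ∫ ω, (W - Y) ω ∂pathMeasure μ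
        = ((∫ ω, Q n ω ∂pathMeasure μ) / (n : ℝ) - l) * b := by
      rw [integral_sub' (hWL.integrable (by norm_num)) (hYL.integrable (by norm_num)), hW, hY,
        integral_div, integral_const_mul,
        integral_sub ((hQ n).integrable (by norm_num)) (integrable_const _),
        integral_sub (hSL.integrable (by norm_num)) (integrable_const _), hSE]
      simp only [integral_const, probReal_univ, smul_eq_mul, one_mul, sub_self, mul_zero, sub_zero]
      rw [← hbb]
      field_simp
    rw [this, abs_mul, abs_of_pos hb0]
    refine (mul_le_mul_of_nonneg_right hln hb0.le).trans_eq ?_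
    rw [← hbb]
    field_simp
  have hsd : √Var[W - Y; pathMeasure μ]
      ≤ 11 * T * y⁻¹ + (K + T + √Var[Q m; pathMeasure μ]) * b⁻¹ := by
    -- The difference is the block approximation at scale `√n`, plus the change of scale from `√(N *
    -- m)` to `√n`, plus a constant without effect on the variance.
    have e : W - Y = fun ω => ((fun ω => b⁻¹ * (Q n - Q.blockSum m N) ω)
        + fun ω => (b⁻¹ - (x * y)⁻¹) * Q.blockSum m N ω) ω
          + ((x * y)⁻¹ * (N * a) - b⁻¹ * (l * n)) := by
      ext ω
      simp only [hW, hY, Pi.sub_apply, Pi.add_apply]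
      ring
    have h1 : MemLp (fun ω => b⁻¹ * (Q n - Q.blockSum m N) ω) 2 (pathMeasure μ) :=
      ((hQ n).sub hSL).const_mul _
    have h2 : MemLp (fun ω => (b⁻¹ - (x * y)⁻¹) * Q.blockSum m N ω) 2 (pathMeasure μ) :=
      hSL.const_mul _
    rw [e, variance_add_const (h1.add h2).1]
    refine (sqrt_variance_add_le h1 h2).trans ?_
    rw [sqrt_variance_const_mul, sqrt_variance_const_mul, hS, abs_of_pos (inv_pos.2 hb0),
      abs_sub_comm, abs_of_nonneg (sub_nonneg.2 (inv_anti₀ (by positivity) hxyb))]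
    have hxb : x * b⁻¹ ≤ y⁻¹ := by
      rw [← div_eq_mul_inv, div_le_iff₀ hb0, inv_mul_eq_div, le_div_iff₀ hy0]
      exact hxyb
    have hd : ((x * y)⁻¹ - b⁻¹) * x ≤ b⁻¹ := by
      have : ((x * y)⁻¹ - b⁻¹) * x = (b - x * y) * (y⁻¹ * b⁻¹) := by field_simp
      rw [this]
      calc (b - x * y) * (y⁻¹ * b⁻¹) ≤ y * (y⁻¹ * b⁻¹) := by
            gcongr
            linarith
        _ = b⁻¹ := by field_simp
    calc _ ≤ b⁻¹ * (11 * T * x + (K + T)) + b⁻¹ * √Var[Q m; pathMeasure μ] := by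
          rw [← mul_assoc]
          gcongr
      _ = 11 * T * (x * b⁻¹) + (K + T + √Var[Q m; pathMeasure μ]) * b⁻¹ := by ring
      _ ≤ _ := by gcongr
  linarith

theorem tendsto_charFun_normalized (hQ : ∀ n, MemLp (Q n) 2 (pathMeasure μ)) {T l s : ℝ}
    (hT : ∀ n m, √Var[Q.defect n m; pathMeasure μ] ≤ T)
    (hl : ∀ n : ℕ, 1 ≤ n → |(∫ ω, Q n ω ∂pathMeasure μ) / (n : ℝ) - l| ≤ T * (n : ℝ)⁻¹)
    (hs : Tendsto (fun n : ℕ => √Var[Q n; pathMeasure μ] / √(n : ℝ)) atTop (𝓝 s)) (t : ℝ) :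
    Tendsto (fun n : ℕ => charFun ((pathMeasure μ).map
        fun ω => (Q n ω - l * (n : ℝ)) / √(n : ℝ)) t) atTop
      (𝓝 (Complex.exp (-(s ^ 2 * t ^ 2 / 2 : ℝ)))) := by
  rw [Metric.tendsto_atTop']
  intro ε hε
  have hc : Continuous fun s : ℝ => Complex.exp (-(s ^ 2 * t ^ 2 / 2 : ℝ)) := by fun_prop
  have hg := Metric.tendsto_nhds.1 ((hc.tendsto s).comp hs) (ε / 4) (by positivity)
  have he : Tendsto (fun m : ℕ => |t| * (11 * T * (√(m : ℝ))⁻¹)) atTop (𝓝 0) := by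
    simpa using (tendsto_inv_sqrt_natCast.const_mul (11 * T)).const_mul |t|
  -- The block length is fixed before `n`: it makes the uniform error small and brings the block
  -- variance `Var (Q m) / m` close enough to `s ^ 2`.
  obtain ⟨m, hm1, hmg, hme⟩ := ((eventually_ge_atTop 1).and
    (hg.and (he.eventually_lt_const (show 0 < ε / 4 by positivity)))).exists
  have hb := Metric.tendsto_nhds.1 ((Q.tendsto_charFun_normalized_blockSum hQ m t).comp
    (Nat.tendsto_div_const_atTop (by omega : m ≠ 0))) (ε / 4) (by positivity)
  have hr : Tendsto (fun n : ℕ => |t| *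
      ((∑ i ∈ Finset.range m, √Var[Q i; pathMeasure μ] + T + √Var[Q m; pathMeasure μ] + T)
        * (√(n : ℝ))⁻¹)) atTop (𝓝 0) := by
    simpa using (tendsto_inv_sqrt_natCast.const_mul
      (∑ i ∈ Finset.range m, √Var[Q i; pathMeasure μ] + T + √Var[Q m; pathMeasure μ] + T)).const_mul
        |t|
  obtain ⟨n₀, hn₀⟩ := eventually_atTop.1 ((eventually_ge_atTop m).and
    (hb.and (hr.eventually_lt_const (show 0 < ε / 4 by positivity))))
  refine ⟨n₀, fun n hn => ?_⟩
  obtain ⟨hmn, h1, h2⟩ := hn₀ n hn.le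
  have h3 := Q.norm_charFun_sub_le hQ hT hl hm1 hmn t
  rw [← dist_eq_norm, mul_add] at h3
  simp only [Function.comp_apply] at h1 hmg
  refine (dist_triangle4 _ _ _ _).trans_lt
    ((add_lt_add (add_lt_add_of_le_of_lt h3 h1) hmg).trans ?_)
  linarith

end RandomWalk.DefectiveAdaptedCocycle

theorem mainTheorem2 {G : Type*} [Group G] [MeasurableSpace G]
    (μ : Measure G) [IsProbabilityMeasure μ]
    (Q : RandomWalk.DefectiveAdaptedCocycle G)
    (hmoment : Q.HasFiniteMoment μ 2)
    (hdev : Q.MomentDeviationInequality μ 2) :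
    (∀ n : ℕ, MemLp (Q n) 2 (RandomWalk.pathMeasure μ)) ∧
    ∃ (l : ℝ) (v : ℝ≥0),
      Q.IsRateOfEscape μ l ∧
      Tendsto (fun n : ℕ => (∫ ω, Q n ω ∂(RandomWalk.pathMeasure μ)) / (n : ℝ)) atTop (𝓝 l) ∧
      Q.IsAsymptoticVariance μ v ∧
      TendstoInDistribution
        (fun (n : ℕ) (ω : RandomWalk.PathSpace G) => (Q n ω - l * (n : ℝ)) / √(n : ℝ))
        atTop (id : ℝ → ℝ) (fun _ => RandomWalk.pathMeasure μ) (gaussianReal 0 v) := by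
  have hQ := Q.memLp_two hmoment hdev
  obtain ⟨T, -, hT, hE⟩ := Q.exists_defect_bound hQ hdev
  obtain ⟨l, hl, hlT⟩ := Q.exists_mean_limit hQ hE
  obtain ⟨s, hs⟩ := Q.exists_sqrt_variance_limit hQ hT
  have hm (n : ℕ) : AEMeasurable (fun ω => (Q n ω - l * (n : ℝ)) / √(n : ℝ))
      (RandomWalk.pathMeasure μ) := (((Q.measurable n).sub_const _).div_const _).aemeasurable
  obtain ⟨v, hv⟩ : ∃ v : ℝ≥0, (v : ℝ) = s ^ 2 := ⟨⟨s ^ 2, sq_nonneg s⟩, rfl⟩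
  refine ⟨hQ, l, v, Q.isRateOfEscape_of_tendsto hQ hl hs, hl, ?_, ?_⟩
  · rw [RandomWalk.DefectiveAdaptedCocycle.IsAsymptoticVariance, hv]
    refine (hs.pow 2).congr fun n => ?_
    rw [div_pow, Real.sq_sqrt (variance_nonneg _ _), Real.sq_sqrt (Nat.cast_nonneg n)]
  · refine ⟨hm, aemeasurable_id, ?_⟩
    refine ProbabilityMeasure.tendsto_iff_tendsto_charFun.2 fun t => ?_
    have := Q.tendsto_charFun_normalized hQ hT hlT hs t
    rw [← hv] at this
    simpa [charFun_gaussianReal, Measure.map_id] using this
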